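/- Let $(X,d)$ be a compact metric space of diameter at most $1$, and let $C(X)$ be the set of continuous functions $X\to\mathbb R$. For $c\in\mathbb R$ let $c_X$ denote the constant function with value $c$, and write $\vee,\wedge$ for maximum (supremum) and minimum. Let $J(X)$ be the set of max-min measures on $X$, i.e. of functionals $\mu\colon C(X)\to\mathbb R$ such that $\mu(c_X)=c$, $\mu(\varphi\vee\psi)=\mu(\varphi)\vee\mu(\psi)$ and $\mu(c_X\wedge\varphi)=c\wedge\mu(\varphi)$ for all $c\in\mathbb R$ and $\varphi,\psi\in C(X)$. Let $I(X)$ be the set of idempotent (max-plus) measures on $X$, i.e. of functionals $\mu\colon C(X)\to\mathbb R$ such that $\mu(c_X)=c$, $\mu(\varphi\vee\psi)=\mu(\varphi)\vee\mu(\psi)$ and $\mu(c_X+\varphi)=c+\mu(\varphi)$ for all $c\in\mathbb R$ and $\varphi,\psi\in C(X)$. Both $J(X)$ and $I(X)$ carry the weak* topology, i.e. the topology of pointwise convergence on $C(X)$. Let $\mathrm{Cone}(X)=(X\times[0,1])/(X\times\{0\})$, with the metric $\check d((x,s),(y,t))=\min\{s,t\}\,d(x,y)+|s-t|$, where $(x,t)$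 also denotes the class of $(x,t)$. A set $K\subset\mathrm{Cone}(X)$ is saturated if $(x,t)\in K$ implies $(x,t')\in K$ for all $t'\in[0,t]$. Let $\bar J(X)$ be the set of nonempty compact saturated subsets $A$ of $\mathrm{Cone}(X)$ such that $(x,1)\in A$ for some $x\in X$, with the Hausdorff metric. Let $\xi\colon[0,1]\to[-\infty,\infty]$ be any order-preserving homeomorphism. For $A\in\bar J(X)$ and $\varphi\in C(X)$ put $$h_X(A)(\varphi)=\bigvee\{\xi(t)\wedge\varphi(x)\mid (x,t)\in A\},\qquad g_X(A)(\varphi)=\bigvee\{\varphi(x)+\ln t\mid (x,t)\in A\},$$ where $\ln 0=-\infty$; these define maps $h_X\colon\bar J(X)\to J(X)$ and $g_X\colon\bar J(X)\to I(X)$. Then $h_X\colon\bar J(X)\to J(X)$ is a homeomorphism, $g_X\colon\bar J(X)\to I(X)$ is a homeomorphism, and consequently the spaces $J(X)$ and $I(X)$ are homeomorphic. -/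

import Mathlib

noncomputable section

namespace MaxMin

open TopologicalSpace

/-! ### Max-min measures and max-plus (idempotent) measures -/

section Measures

variable (X : Type*) [TopologicalSpace X]

/-- The axioms of a max-min measure on `X`. No continuity is required. -/
structure IsMaxMinMeasure (μ : C(X, ℝ) → ℝ) : Prop where
  map_const : ∀ c : ℝ, μ (ContinuousMap.const X c) = c
  map_sup : ∀ φ ψ : C(X, ℝ), μ (φ ⊔ ψ) = max (μ φ) (μ ψ)
  map_const_inf : ∀ (c : ℝ) (φ : C(X, ℝ)), μ (ContinuousMap.const X c ⊓ φ) = min c (μ φ)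

/-- The axioms of a max-plus (idempotent) measure on `X`. No continuity is required. -/
structure IsIdempotentMeasure (μ : C(X, ℝ) → ℝ) : Prop where
  map_const : ∀ c : ℝ, μ (ContinuousMap.const X c) = c
  map_sup : ∀ φ ψ : C(X, ℝ), μ (φ ⊔ ψ) = max (μ φ) (μ ψ)
  map_const_add : ∀ (c : ℝ) (φ : C(X, ℝ)), μ (ContinuousMap.const X c + φ) = c + μ φ

/-- The space `J(X)` of max-min measures with the weak* topology, i.e. the topology of pointwise
convergence: the subspace topology inherited from the product `C(X, ℝ) → ℝ`. -/
abbrev J : Type _ := {μ : C(X, ℝ) → ℝ // IsMaxMinMeasure X μ}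

/-- The space `I(X)` of idempotent measures with the weak* topology. -/
abbrev I : Type _ := {μ : C(X, ℝ) → ℝ // IsIdempotentMeasure X μ}

end Measures

/-! ### The cone over a metric space of diameter at most one -/

/-- The identification of `X × {0}` to a point. -/
def coneSetoid (X : Type*) : Setoid (X × unitInterval) where
  r p q := p = q ∨ (p.2 = 0 ∧ q.2 = 0)
  iseqv :=
    { refl := fun _ => Or.inl rfl
      symm := by
        rintro p q (h | ⟨h, h'⟩)
        · exact Or.inl h.symm
        · exact Or.inr ⟨h', h⟩
      trans := by
        rintro p q r (rfl | ⟨h, h'⟩) (rfl | ⟨k, k'⟩)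
        · exact Or.inl rfl
        · exact Or.inr ⟨k, k'⟩
        · exact Or.inr ⟨h, h'⟩
        · exact Or.inr ⟨h, k'⟩ }

/-- The cone `(X × [0,1]) / (X × {0})`. -/
def Cone (X : Type*) : Type _ := Quotient (coneSetoid X)

/-- The class of `(x, t)` in the cone. -/
def Cone.mk {X : Type*} (x : X) (t : unitInterval) : Cone X := Quotient.mk (coneSetoid X) (x, t)

theorem Cone.exists_mk {X : Type*} (p : Cone X) : ∃ x t, p = Cone.mk x t := by
  induction p using Quotient.inductionOn with
  | h a => exact ⟨a.1, a.2, rfl⟩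

/-- The metric space `X` has diameter at most one. -/
class DiamLeOne (X : Type*) [MetricSpace X] : Prop where
  dist_le_one : ∀ x y : X, dist x y ≤ 1

section ConeMetric

variable {X : Type*} [MetricSpace X]

/-- The distance `min s t * d(x, y) + |s - t|` between `(x, s)` and `(y, t)` in the cone. -/
def Cone.distFun : Cone X → Cone X → ℝ :=
  Quotient.lift₂
    (fun p q => min (p.2 : ℝ) (q.2 : ℝ) * dist p.1 q.1 + |(p.2 : ℝ) - (q.2 : ℝ)|) (by
      rintro ⟨x, s⟩ ⟨y, t⟩ ⟨x', s'⟩ ⟨y', t'⟩ h k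
      have hs := s.2.1
      have ht := t.2.1
      have hs' := s'.2.1
      have ht' := t'.2.1
      rcases h with h | ⟨h, h'⟩ <;> rcases k with k | ⟨k, k'⟩ <;> simp_all)

theorem Cone.distFun_mk (x y : X) (s t : unitInterval) :
    Cone.distFun (Cone.mk x s) (Cone.mk y t)
      = min (s : ℝ) (t : ℝ) * dist x y + |(s : ℝ) - (t : ℝ)| := rfl

/-- The metric of the cone. -/
instance Cone.instMetricSpace [DiamLeOne X] : MetricSpace (Cone X) where
  dist := Cone.distFun
  dist_self p := by
    obtain ⟨x, t, rfl⟩ := p.exists_mk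
    simp [Cone.distFun_mk]
  dist_comm p q := by
    obtain ⟨x, s, rfl⟩ := p.exists_mk
    obtain ⟨y, t, rfl⟩ := q.exists_mk
    rw [Cone.distFun_mk, Cone.distFun_mk, min_comm, dist_comm, abs_sub_comm]
  dist_triangle p q r := by
    obtain ⟨x, s, rfl⟩ := p.exists_mk
    obtain ⟨y, t, rfl⟩ := q.exists_mk
    obtain ⟨z, u, rfl⟩ := r.exists_mk
    rw [Cone.distFun_mk, Cone.distFun_mk, Cone.distFun_mk]
    have hs := s.2.1
    have ht := t.2.1
    have hu := u.2.1
    have h := dist_triangle x y z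
    have h1 := DiamLeOne.dist_le_one x z
    have n1 : 0 ≤ dist x y := dist_nonneg
    have n2 : 0 ≤ dist y z := dist_nonneg
    have n3 : 0 ≤ dist x z := dist_nonneg
    generalize dist x y = a at *
    generalize dist y z = b at *
    generalize dist x z = c at *
    generalize (s : ℝ) = s at *
    generalize (t : ℝ) = t at *
    generalize (u : ℝ) = u at *
    rcases le_total s t with hst | hst <;> rcases le_total t u with htu | htu <;>
      rcases le_total s u with hsu | hsu <;>
      simp only [min_eq_left, min_eq_right, abs_of_nonneg, abs_of_nonpos, sub_nonneg,
        sub_nonpos, hst, htu, hsu] <;>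
      nlinarith [mul_nonneg hs n1, mul_nonneg hs n2, mul_nonneg ht n1, mul_nonneg ht n2,
        mul_nonneg hu n1, mul_nonneg hu n2, mul_nonneg (sub_nonneg.2 hst) n1,
        mul_nonneg (sub_nonneg.2 hst) n2, mul_nonneg (sub_nonneg.2 htu) n1,
        mul_nonneg (sub_nonneg.2 htu) n2, mul_nonneg (sub_nonneg.2 hst) (sub_nonneg.2 h1),
        mul_nonneg (sub_nonneg.2 htu) (sub_nonneg.2 h1), mul_nonneg hs (sub_nonneg.2 h),
        mul_nonneg ht (sub_nonneg.2 h), mul_nonneg hu (sub_nonneg.2 h)]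
  eq_of_dist_eq_zero := by
    intro p q hpq
    obtain ⟨x, s, rfl⟩ := p.exists_mk
    obtain ⟨y, t, rfl⟩ := q.exists_mk
    change Cone.distFun _ _ = 0 at hpq
    rw [Cone.distFun_mk] at hpq
    have n1 : 0 ≤ min (s : ℝ) (t : ℝ) * dist x y :=
      mul_nonneg (le_min s.2.1 t.2.1) dist_nonneg
    have n2 := abs_nonneg ((s : ℝ) - (t : ℝ))
    have h1 : |(s : ℝ) - (t : ℝ)| = 0 := by linarith
    have hst : s = t := Subtype.ext (sub_eq_zero.1 (abs_eq_zero.1 h1))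
    subst hst
    have h2 : (s : ℝ) * dist x y = 0 := by
      rw [min_self] at hpq
      linarith
    refine Quotient.sound ?_
    rcases mul_eq_zero.1 h2 with h3 | h3
    · exact Or.inr ⟨Subtype.ext h3, Subtype.ext h3⟩
    · exact Or.inl (by rw [dist_eq_zero.1 h3])

end ConeMetric

/-- A subset of the cone is saturated if with `(x, t)` it contains all `(x, t')`, `t' ≤ t`. -/
def IsSaturated {X : Type*} (K : Set (Cone X)) : Prop :=
  ∀ (x : X) (t : unitInterval), Cone.mk x t ∈ K → ∀ t' : unitInterval, t' ≤ t → Cone.mk x t' ∈ K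

/-- The space of nonempty compact saturated subsets of the cone that meet the top level, a subspace
of the hyperspace `NonemptyCompacts (Cone X)` with its Hausdorff metric. -/
abbrev JBar (X : Type*) [MetricSpace X] [DiamLeOne X] : Type _ :=
  {A : NonemptyCompacts (Cone X) // IsSaturated (A : Set (Cone X)) ∧
    ∃ x : X, Cone.mk x 1 ∈ (A : Set (Cone X))}

/-! ### The maps to the spaces of measures -/

section Maps

variable {X : Type*} [MetricSpace X] [DiamLeOne X]

/-- The supremum of `min (ξ t) (φ x)` over all `(x, t) ∈ A`, as an extended real. -/
def hSup (ξ : unitInterval ≃o EReal) (A : JBar X) (φ : C(X, ℝ)) : EReal :=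
  ⨆ (x : X) (t : unitInterval) (_ : Cone.mk x t ∈ (A.1 : Set (Cone X))), min (ξ t) (φ x : EReal)

/-- The logarithm on the unit interval, with `ln 0 = -∞`. -/
def lnI (t : unitInterval) : EReal := ENNReal.log (ENNReal.ofReal (t : ℝ))

/-- The supremum of `φ x + ln t` over all `(x, t) ∈ A`, as an extended real. -/
def gSup (A : JBar X) (φ : C(X, ℝ)) : EReal :=
  ⨆ (x : X) (t : unitInterval) (_ : Cone.mk x t ∈ (A.1 : Set (Cone X))), (φ x : EReal) + lnI t

theorem ereal_coe_max (a b : ℝ) : ((max a b : ℝ) : EReal) = max (a : EReal) (b : EReal) :=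
  EReal.coe_strictMono.monotone.map_max

theorem ereal_coe_min (a b : ℝ) : ((min a b : ℝ) : EReal) = min (a : EReal) (b : EReal) :=
  EReal.coe_strictMono.monotone.map_min

theorem lnI_one : lnI 1 = 0 := by simp [lnI]

theorem lnI_le (t : unitInterval) : lnI t ≤ 0 := by
  rw [← lnI_one]
  exact ENNReal.log_monotone (ENNReal.ofReal_le_ofReal t.2.2)

theorem le_hSup (ξ : unitInterval ≃o EReal) (A : JBar X) (φ : C(X, ℝ)) {x : X} {t : unitInterval}
    (h : Cone.mk x t ∈ (A.1 : Set (Cone X))) : min (ξ t) (φ x : EReal) ≤ hSup ξ A φ :=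
  le_iSup_of_le x (le_iSup_of_le t (le_iSup_of_le h le_rfl))

theorem hSup_le (ξ : unitInterval ≃o EReal) (A : JBar X) (φ : C(X, ℝ)) {b : EReal}
    (h : ∀ x t, Cone.mk x t ∈ (A.1 : Set (Cone X)) → min (ξ t) (φ x : EReal) ≤ b) :
    hSup ξ A φ ≤ b :=
  iSup_le fun x => iSup_le fun t => iSup_le fun hx => h x t hx

theorem le_gSup (A : JBar X) (φ : C(X, ℝ)) {x : X} {t : unitInterval}
    (h : Cone.mk x t ∈ (A.1 : Set (Cone X))) : (φ x : EReal) + lnI t ≤ gSup A φ :=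
  le_iSup_of_le x (le_iSup_of_le t (le_iSup_of_le h le_rfl))

theorem gSup_le (A : JBar X) (φ : C(X, ℝ)) {b : EReal}
    (h : ∀ x t, Cone.mk x t ∈ (A.1 : Set (Cone X)) → (φ x : EReal) + lnI t ≤ b) :
    gSup A φ ≤ b :=
  iSup_le fun x => iSup_le fun t => iSup_le fun hx => h x t hx

theorem hSup_sup (ξ : unitInterval ≃o EReal) (A : JBar X) (φ ψ : C(X, ℝ)) :
    hSup ξ A (φ ⊔ ψ) = max (hSup ξ A φ) (hSup ξ A ψ) := by
  apply le_antisymm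
  · refine hSup_le ξ A _ fun x t h => ?_
    rw [ContinuousMap.sup_apply, ereal_coe_max, min_max_distrib_left]
    exact max_le_max (le_hSup ξ A φ h) (le_hSup ξ A ψ h)
  · refine max_le (hSup_le ξ A _ fun x t h => ?_) (hSup_le ξ A _ fun x t h => ?_)
    · refine le_trans (min_le_min_left _ ?_) (le_hSup ξ A (φ ⊔ ψ) h)
      exact EReal.coe_le_coe_iff.2 le_sup_left
    · refine le_trans (min_le_min_left _ ?_) (le_hSup ξ A (φ ⊔ ψ) h)
      exact EReal.coe_le_coe_iff.2 le_sup_right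

theorem gSup_sup (A : JBar X) (φ ψ : C(X, ℝ)) :
    gSup A (φ ⊔ ψ) = max (gSup A φ) (gSup A ψ) := by
  apply le_antisymm
  · refine gSup_le A _ fun x t h => ?_
    rcases le_total (φ x) (ψ x) with hx | hx
    · rw [ContinuousMap.sup_apply, sup_eq_right.2 hx]
      exact le_max_of_le_right (le_gSup A ψ h)
    · rw [ContinuousMap.sup_apply, sup_eq_left.2 hx]
      exact le_max_of_le_left (le_gSup A φ h)
  · refine max_le (gSup_le A _ fun x t h => ?_) (gSup_le A _ fun x t h => ?_)
    · refine le_trans (add_le_add_left ?_ _) (le_gSup A (φ ⊔ ψ) h)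
      exact EReal.coe_le_coe_iff.2 le_sup_left
    · refine le_trans (add_le_add_left ?_ _) (le_gSup A (φ ⊔ ψ) h)
      exact EReal.coe_le_coe_iff.2 le_sup_right

theorem hSup_const (ξ : unitInterval ≃o EReal) (A : JBar X) (c : ℝ) :
    hSup ξ A (ContinuousMap.const X c) = c := by
  apply le_antisymm
  · exact hSup_le ξ A _ fun x t _ => min_le_right _ _
  · obtain ⟨x, hx⟩ := A.2.2
    have h := le_hSup ξ A (ContinuousMap.const X c) hx
    have h1 : ξ 1 = ⊤ := ξ.map_top
    rwa [h1, min_eq_right le_top] at h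

theorem gSup_const (A : JBar X) (c : ℝ) : gSup A (ContinuousMap.const X c) = c := by
  apply le_antisymm
  · refine gSup_le A _ fun x t _ => ?_
    simpa using add_le_add_right (lnI_le t) (c : EReal)
  · obtain ⟨x, hx⟩ := A.2.2
    have h := le_gSup A (ContinuousMap.const X c) hx
    rwa [lnI_one, add_zero] at h

theorem hSup_const_inf (ξ : unitInterval ≃o EReal) (A : JBar X) (c : ℝ) (φ : C(X, ℝ)) :
    hSup ξ A (ContinuousMap.const X c ⊓ φ) = min (c : EReal) (hSup ξ A φ) := by
  have key : ∀ (x : X) (t : unitInterval),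
      min (ξ t) (((ContinuousMap.const X c ⊓ φ) x : ℝ) : EReal)
        = min (c : EReal) (min (ξ t) (φ x : EReal)) := by
    intro x t
    rw [ContinuousMap.inf_apply, ereal_coe_min, min_left_comm]
    rfl
  simp only [hSup, key]
  rw [inf_iSup_eq]
  refine iSup_congr fun x => ?_
  rw [inf_iSup_eq]
  refine iSup_congr fun t => ?_
  rw [inf_iSup_eq]

theorem gSup_const_add_le (A : JBar X) (c : ℝ) (φ : C(X, ℝ)) :
    gSup A (ContinuousMap.const X c + φ) ≤ (c : EReal) + gSup A φ := by
  refine gSup_le A _ fun x t h => ?_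
  rw [ContinuousMap.add_apply, ContinuousMap.const_apply, EReal.coe_add, add_assoc]
  exact add_le_add_right (le_gSup A φ h) _

variable [CompactSpace X]

/-- The supremum defining `hMap` is finite. -/
theorem coe_toReal_hSup (ξ : unitInterval ≃o EReal) (A : JBar X) (φ : C(X, ℝ)) :
    ((hSup ξ A φ).toReal : EReal) = hSup ξ A φ := by
  obtain ⟨x, hx⟩ := A.2.2
  apply EReal.coe_toReal
  · refine ne_top_of_le_ne_top (EReal.coe_ne_top ‖φ‖) (hSup_le ξ A φ fun y t _ => ?_)
    exact (min_le_right _ _).trans (EReal.coe_le_coe_iff.2 (φ.apply_le_norm y))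
  · refine ne_bot_of_le_ne_bot (EReal.coe_ne_bot (φ x)) ?_
    have h := le_hSup ξ A φ hx
    have h1 : ξ 1 = ⊤ := ξ.map_top
    rwa [h1, min_eq_right le_top] at h

/-- The supremum defining `gMap` is finite. -/
theorem coe_toReal_gSup (A : JBar X) (φ : C(X, ℝ)) :
    ((gSup A φ).toReal : EReal) = gSup A φ := by
  obtain ⟨x, hx⟩ := A.2.2
  apply EReal.coe_toReal
  · refine ne_top_of_le_ne_top (EReal.coe_ne_top ‖φ‖) (gSup_le A φ fun y t _ => ?_)
    refine le_trans ?_ (EReal.coe_le_coe_iff.2 (φ.apply_le_norm y))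
    simpa using add_le_add_right (lnI_le t) (φ y : EReal)
  · refine ne_bot_of_le_ne_bot (EReal.coe_ne_bot (φ x)) ?_
    have h := le_gSup A φ hx
    rwa [lnI_one, add_zero] at h

/-- The map `A ↦ (φ ↦ sup {min (ξ t) (φ x) | (x, t) ∈ A})`. An order isomorphism
`ξ : [0,1] ≃o [-∞,∞]` is the same thing as an order-preserving homeomorphism. -/
def hMap (ξ : unitInterval ≃o EReal) (A : JBar X) : J X :=
  ⟨fun φ => (hSup ξ A φ).toReal,
    { map_const := fun c => by rw [hSup_const, EReal.toReal_coe]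
      map_sup := fun φ ψ => by
        rw [← EReal.coe_eq_coe_iff, ereal_coe_max]
        simp only [coe_toReal_hSup]
        exact hSup_sup ξ A φ ψ
      map_const_inf := fun c φ => by
        rw [← EReal.coe_eq_coe_iff, ereal_coe_min]
        simp only [coe_toReal_hSup]
        exact hSup_const_inf ξ A c φ }⟩

/-- The map `A ↦ (φ ↦ sup {φ x + ln t | (x, t) ∈ A})`. -/
def gMap (A : JBar X) : I X :=
  ⟨fun φ => (gSup A φ).toReal,
    { map_const := fun c => by rw [gSup_const, EReal.toReal_coe]
      map_sup := fun φ ψ => by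
        rw [← EReal.coe_eq_coe_iff, ereal_coe_max]
        simp only [coe_toReal_gSup]
        exact gSup_sup A φ ψ
      map_const_add := fun c φ => by
        have key : ∀ (c : ℝ) (φ : C(X, ℝ)),
            (gSup A (ContinuousMap.const X c + φ)).toReal ≤ c + (gSup A φ).toReal := by
          intro c φ
          rw [← EReal.coe_le_coe_iff, EReal.coe_add]
          simp only [coe_toReal_gSup]
          exact gSup_const_add_le A c φ
        have h1 := key c φ
        have h2 := key (-c) (ContinuousMap.const X c + φ)
        have h3 : ContinuousMap.const X (-c) + (ContinuousMap.const X c + φ) = φ := by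
          ext x
          simp
        rw [h3] at h2
        linarith }⟩

end Maps

end MaxMin

end

/-!
Both maps are instances of one construction. Call a function `K : [0,1] → ℝ → [-∞,∞]` a cone kernel
if it is continuous, monotone, `K 0 r = -∞`, `K 1 r = r`, and `K` separates the levels of the cone.
Both `min (ξ t) r` and `r + ln t` are cone kernels, and `h`, `g` are `A ↦ sup_{(x,t) ∈ A} K t (φ x)`.

The space `JBar X` is compact: the cone is compact, so its Vietoris hyperspace is, and saturated
sets meeting the top level form a closed subset of it. The spaces of measures are Hausdorff. Hence it
suffices that `A ↦ sup_A K` is continuous (`continuous_kernelSup`), injective (`kernelSup_injective`)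
and onto (`exists_kernelSup_eq`).

* Continuity: the supremum of a continuous function over a compact set is continuous in the set.
* Injectivity: if `(x, t) ∈ A \ B`, then by saturation `B` lies below some level `t₀ < t` over a
  neighbourhood of `x`, and a Urysohn function peaking at `x` has a smaller supremum over `B`.
* Surjectivity: a measure `μ` is represented by the largest candidate, the set of all `(x, t)` with
  `K t (φ x) ≤ μ φ` for every `φ`. If `b` exceeds the supremum of `K t (φ x)` over this set, then
  every point `x` has a function `θ` with `φ x < θ x` and `μ θ ≤ b`; a finite maximum of such
  functions dominates `φ` by compactness, so `μ φ ≤ b`. Only the existence of `θ` uses the axioms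
  particular to max-min or max-plus measures; see `IsMaxMinMeasure.exists_separating` and
  `IsIdempotentMeasure.exists_separating`.
-/

noncomputable section

namespace MaxMin

open TopologicalSpace Set

/-! ### Topology of the cone -/

section ConeTopology

variable {X : Type*}

theorem Cone.surjective_mk :
    Function.Surjective fun p : X × unitInterval => Cone.mk p.1 p.2 := fun p => by
  obtain ⟨x, t, rfl⟩ := p.exists_mk
  exact ⟨(x, t), rfl⟩

theorem Cone.mk_zero (x y : X) : Cone.mk x 0 = Cone.mk y 0 :=
  Quotient.sound (Or.inr ⟨rfl, rfl⟩)

/-- Multiplication of the height coordinate of the cone by `s`. -/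
def Cone.scale (s : unitInterval) : Cone X → Cone X :=
  Quotient.lift (fun p => Cone.mk p.1 (s * p.2)) (by
    rintro ⟨x, t⟩ ⟨y, u⟩ (h | ⟨h, h'⟩)
    · rw [h]
    · dsimp only at h h' ⊢
      rw [h, h', mul_zero]
      exact Cone.mk_zero x y)

theorem Cone.scale_mk (s : unitInterval) (x : X) (t : unitInterval) :
    Cone.scale s (Cone.mk x t) = Cone.mk x (s * t) := rfl

/-- Saturation as stability under the continuous maps `scale s`, which makes it a closed condition. -/
theorem isSaturated_iff_scale {A : Set (Cone X)} :
    IsSaturated A ↔ ∀ s : unitInterval, Cone.scale s '' A ⊆ A := by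
  constructor
  · rintro h s _ ⟨p, hp, rfl⟩
    obtain ⟨x, t, rfl⟩ := p.exists_mk
    exact h x t hp _ unitInterval.mul_le_right
  · intro h x t hx t' ht'
    rcases eq_or_ne t 0 with rfl | h0
    · rwa [le_antisymm ht' (unitInterval.nonneg t')]
    · have h0' : (t : ℝ) ≠ 0 := fun h => h0 (Subtype.ext h)
      have hs : (t' : ℝ) / t ∈ unitInterval :=
        ⟨div_nonneg t'.2.1 t.2.1, div_le_one_of_le₀ ht' t.2.1⟩
      have : t' = ⟨(t' : ℝ) / t, hs⟩ * t := by
        apply Subtype.ext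
        change (t' : ℝ) = t' / t * t
        field_simp
      rw [this, ← Cone.scale_mk]
      exact h _ ⟨_, hx, rfl⟩

variable [MetricSpace X] [DiamLeOne X]

theorem Cone.continuous_mk : Continuous fun p : X × unitInterval => Cone.mk p.1 p.2 := by
  rw [continuous_iff_continuousAt]
  rintro ⟨x, t⟩
  rw [ContinuousAt, tendsto_iff_dist_tendsto_zero]
  change Filter.Tendsto
    (fun p : X × unitInterval => min (p.2 : ℝ) (t : ℝ) * dist p.1 x + |(p.2 : ℝ) - (t : ℝ)|) _ _
  have h : Continuous fun p : X × unitInterval =>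
      min (p.2 : ℝ) (t : ℝ) * dist p.1 x + |(p.2 : ℝ) - (t : ℝ)| := by fun_prop
  simpa using h.tendsto (x, t)

instance Cone.instCompactSpace [CompactSpace X] : CompactSpace (Cone X) :=
  Cone.surjective_mk.compactSpace Cone.continuous_mk

theorem Cone.isQuotientMap_mk [CompactSpace X] :
    Topology.IsQuotientMap fun p : X × unitInterval => Cone.mk p.1 p.2 :=
  Cone.continuous_mk.isClosedMap.isQuotientMap Cone.continuous_mk Cone.surjective_mk

theorem Cone.continuous_scale [CompactSpace X] (s : unitInterval) :
    Continuous (Cone.scale s : Cone X → Cone X) := by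
  rw [Cone.isQuotientMap_mk.continuous_iff]
  change Continuous fun p : X × unitInterval => Cone.mk p.1 (s * p.2)
  exact Cone.continuous_mk.comp (f := fun p : X × unitInterval => (p.1, s * p.2)) (by fun_prop)

theorem isClosed_jBar [CompactSpace X] :
    IsClosed {A : NonemptyCompacts (Cone X) | IsSaturated (A : Set (Cone X)) ∧
      ∃ x : X, Cone.mk x 1 ∈ (A : Set (Cone X))} := by
  have hsat : IsClosed {A : NonemptyCompacts (Cone X) | IsSaturated (A : Set (Cone X))} := by
    simp only [isSaturated_iff_scale]
    rw [ofPred_forall]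
    refine isClosed_iInter fun s => ?_
    -- `scale s '' A ⊆ A` is the equation `map (scale s) A ⊔ A = A` in a Hausdorff space.
    have h : IsClosed {A : NonemptyCompacts (Cone X) |
        A.map (Cone.scale s) (Cone.continuous_scale s) ⊔ A = A} :=
      isClosed_eq (((Cone.continuous_scale s).nonemptyCompacts_map).sup continuous_id) continuous_id
    convert h using 2
    ext A
    rw [← SetLike.coe_set_eq, NonemptyCompacts.coe_sup, NonemptyCompacts.coe_map,
      union_eq_right]
  have htop : IsClosed (range fun x : X => Cone.mk x 1) :=
    (isCompact_range (Cone.continuous_mk.comp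
      (f := fun x : X => (x, (1 : unitInterval))) (by fun_prop))).isClosed
  convert hsat.inter (NonemptyCompacts.isClosed_inter_nonempty_of_isClosed htop) using 1
  ext A
  refine and_congr_right fun _ => ⟨?_, ?_⟩
  · rintro ⟨x, hx⟩
    exact ⟨_, hx, x, rfl⟩
  · rintro ⟨_, hx, x, rfl⟩
    exact ⟨x, hx⟩

instance instCompactSpaceJBar [CompactSpace X] : CompactSpace (JBar X) :=
  isCompact_iff_compactSpace.1 isClosed_jBar.isCompact

end ConeTopology

/-! ### Suprema of cone kernels -/

/-- A function `K : [0,1] → ℝ → [-∞,∞]` through which subsets of the cone act on continuous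
functions by `φ ↦ sup K t (φ x)`. The condition `zero_left` makes `K t (φ x)` well defined on the
cone, and `exists_lt` makes the action tell different levels apart. -/
structure IsConeKernel (K : unitInterval → ℝ → EReal) : Prop where
  continuous : Continuous fun p : unitInterval × ℝ => K p.1 p.2
  mono : ∀ {s t : unitInterval} {q r : ℝ}, s ≤ t → q ≤ r → K s q ≤ K t r
  zero_left : ∀ r, K 0 r = ⊥
  one_left : ∀ r, K 1 r = r
  exists_lt : ∀ {s t : unitInterval}, s < t → ∃ r, K s r < K t r

section Kernel

variable {X : Type*} [MetricSpace X] {K : unitInterval → ℝ → EReal}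

/-- The function `(x, t) ↦ K t (φ x)` on the cone. -/
def kernelEval (hK : IsConeKernel K) (φ : C(X, ℝ)) : Cone X → EReal :=
  Quotient.lift (fun p => K p.2 (φ p.1)) (by
    rintro ⟨x, t⟩ ⟨y, u⟩ (h | ⟨h, h'⟩)
    · rw [h]
    · dsimp only at h h' ⊢
      rw [h, h', hK.zero_left, hK.zero_left])

theorem kernelEval_mk (hK : IsConeKernel K) (φ : C(X, ℝ)) (x : X) (t : unitInterval) :
    kernelEval hK φ (Cone.mk x t) = K t (φ x) := rfl

variable [DiamLeOne X]

/-- The supremum of `K t (φ x)` over all `(x, t) ∈ A`. -/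
def kernelSup (K : unitInterval → ℝ → EReal) (A : JBar X) (φ : C(X, ℝ)) : EReal :=
  ⨆ (x : X) (t : unitInterval) (_ : Cone.mk x t ∈ (A.1 : Set (Cone X))), K t (φ x)

theorem kernelSup_le {A : JBar X} {φ : C(X, ℝ)} {b : EReal}
    (h : ∀ x t, Cone.mk x t ∈ (A.1 : Set (Cone X)) → K t (φ x) ≤ b) : kernelSup K A φ ≤ b :=
  iSup_le fun x => iSup_le fun t => iSup_le fun hx => h x t hx

theorem le_kernelSup {A : JBar X} (φ : C(X, ℝ)) {x : X} {t : unitInterval}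
    (h : Cone.mk x t ∈ (A.1 : Set (Cone X))) : K t (φ x) ≤ kernelSup K A φ :=
  le_iSup_of_le x (le_iSup_of_le t (le_iSup_of_le h le_rfl))

theorem kernelSup_eq_sSup (hK : IsConeKernel K) (A : JBar X) (φ : C(X, ℝ)) :
    kernelSup K A φ = sSup (kernelEval hK φ '' (A.1 : Set (Cone X))) := by
  refine le_antisymm (kernelSup_le fun x t h => le_sSup ⟨_, h, rfl⟩) (sSup_le ?_)
  rintro _ ⟨p, hp, rfl⟩
  obtain ⟨x, t, rfl⟩ := p.exists_mk
  exact le_kernelSup φ hp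

/-- Over a neighbourhood of a point `x`, a closed saturated set missing `(x, t)` stays below a level
smaller than `t`. -/
theorem exists_level_lt {B : Set (Cone X)} (hB : IsClosed B) (hsat : IsSaturated B) {x : X}
    {t : unitInterval} (h0 : t ≠ 0) (hx : Cone.mk x t ∉ B) :
    ∃ t₀ < t, ∃ U : Set X, IsOpen U ∧ x ∈ U ∧
      ∀ y ∈ U, ∀ s, Cone.mk y s ∈ B → s ≤ t₀ := by
  have hV : IsOpen {s : unitInterval | Cone.mk x s ∉ B} :=
    hB.isOpen_compl.preimage (Cone.continuous_mk.comp
      (f := fun s : unitInterval => (x, s)) (by fun_prop))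
  obtain ⟨l, hl, hlt⟩ := exists_Ioc_subset_of_mem_nhds (hV.mem_nhds hx)
    ⟨0, unitInterval.pos_iff_ne_zero.2 h0⟩
  obtain ⟨t₀, hlt₀, ht₀⟩ := exists_between hl
  refine ⟨t₀, ht₀, {y | Cone.mk y t₀ ∉ B}, ?_, hlt ⟨hlt₀, ht₀.le⟩, fun y hy s hs => ?_⟩
  · exact hB.isOpen_compl.preimage (Cone.continuous_mk.comp
      (f := fun y : X => (y, t₀)) (by fun_prop))
  · by_contra! h
    exact hy (hsat y s hs t₀ h.le)

/-- A set in `JBar X` is contained in every other one whose suprema are at least as large. -/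
theorem subset_of_kernelSup_le (hK : IsConeKernel K) {A B : JBar X}
    (h : ∀ φ : C(X, ℝ), kernelSup K A φ ≤ kernelSup K B φ) :
    (A.1 : Set (Cone X)) ⊆ B.1 := by
  intro p hp
  obtain ⟨x, t, rfl⟩ := p.exists_mk
  by_contra hx
  have h0 : t ≠ 0 := by
    rintro rfl
    obtain ⟨y, hy⟩ := B.2.2
    rw [Cone.mk_zero x y] at hx
    exact hx (B.2.1 y 1 hy 0 (unitInterval.nonneg 1))
  obtain ⟨t₀, ht₀, U, hU, hxU, hB⟩ :=
    exists_level_lt B.1.isCompact.isClosed B.2.1 h0 hx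
  obtain ⟨r, hr⟩ := hK.exists_lt ht₀
  obtain ⟨m, -, hm⟩ := EReal.lt_iff_exists_real_btwn.1 (bot_le.trans_lt hr)
  have hmr : m ≤ r := by
    rw [← EReal.coe_le_coe_iff, ← hK.one_left r]
    exact hm.le.trans (hK.mono (unitInterval.le_one t) le_rfl)
  obtain ⟨f, hf0, hf1, hf⟩ := exists_continuous_zero_one_of_isClosed
    (isClosed_singleton : IsClosed {x}) hU.isClosed_compl
    (disjoint_compl_right_iff_subset.2 (singleton_subset_iff.2 hxU))
  -- `φ` equals `r` at `x`, is at most `r` everywhere and equals `m` off `U`.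
  let φ : C(X, ℝ) := ContinuousMap.const X r + (m - r) • f
  have hφ : ∀ y, φ y = r + (m - r) * f y := fun y => rfl
  have hA : K t r ≤ kernelSup K A φ := by
    have h1 := le_kernelSup (K := K) φ hp
    rwa [hφ, hf0 rfl, Pi.zero_apply, mul_zero, add_zero] at h1
  have hB' : kernelSup K B φ ≤ max (K t₀ r) m := by
    refine kernelSup_le fun y s hs => ?_
    by_cases hy : y ∈ U
    · refine le_max_of_le_left (hK.mono (hB y hy s hs) ?_)
      rw [hφ]
      nlinarith [(hf y).1]
    · refine le_max_of_le_right ?_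
      rw [← hK.one_left m]
      refine hK.mono (unitInterval.le_one s) ?_
      rw [hφ, hf1 hy, Pi.one_apply, mul_one, add_sub_cancel]
  exact absurd ((hA.trans (h φ)).trans hB') (not_le.2 (max_lt hr hm))

theorem kernelSup_injective (hK : IsConeKernel K) :
    Function.Injective (kernelSup K : JBar X → C(X, ℝ) → EReal) := fun _ _ h =>
  Subtype.ext <| NonemptyCompacts.ext <| Subset.antisymm
    (subset_of_kernelSup_le hK fun φ => (congrFun h φ).le)
    (subset_of_kernelSup_le hK fun φ => (congrFun h φ).ge)

variable [CompactSpace X]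

theorem continuous_kernelEval (hK : IsConeKernel K) (φ : C(X, ℝ)) :
    Continuous (kernelEval hK φ) := by
  rw [Cone.isQuotientMap_mk.continuous_iff]
  change Continuous fun p : X × unitInterval => K p.2 (φ p.1)
  exact hK.continuous.comp (f := fun p : X × unitInterval => (p.2, φ p.1)) (by fun_prop)

/-- The supremum of a continuous function over a nonempty compact set is continuous in the set. -/
theorem continuous_sSup_image_nonemptyCompacts {Y : Type*} [TopologicalSpace Y] {F : Y → EReal}
    (hF : Continuous F) :
    Continuous fun A : NonemptyCompacts Y => sSup (F '' (A : Set Y)) := by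
  refine continuous_iff_lower_upperSemicontinuous.2 ⟨?_, ?_⟩
  · refine lowerSemicontinuous_iff_isOpen_preimage.2 fun c => ?_
    have hU : IsOpen (F ⁻¹' Ioi c) := isOpen_Ioi.preimage hF
    convert NonemptyCompacts.isOpen_inter_nonempty_of_isOpen hU using 1
    ext A
    change c < sSup (F '' (A : Set Y)) ↔ ((A : Set Y) ∩ F ⁻¹' Ioi c).Nonempty
    rw [lt_sSup_iff]
    constructor
    · rintro ⟨_, ⟨y, hy, rfl⟩, h⟩
      exact ⟨y, hy, h⟩
    · rintro ⟨y, hy, h⟩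
      exact ⟨_, ⟨y, hy, rfl⟩, h⟩
  · refine upperSemicontinuous_iff_isOpen_preimage.2 fun c => ?_
    have hU : IsOpen (F ⁻¹' Iio c) := isOpen_Iio.preimage hF
    convert NonemptyCompacts.isOpen_subsets_of_isOpen hU using 1
    ext A
    change sSup (F '' (A : Set Y)) < c ↔ (A : Set Y) ⊆ F ⁻¹' Iio c
    constructor
    · exact fun h y hy => (le_sSup (mem_image_of_mem F hy)).trans_lt h
    · intro h
      obtain ⟨y, hy, hsup⟩ := A.isCompact.exists_sSup_image_eq A.nonempty hF.continuousOn
      rw [hsup]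
      exact h hy

theorem continuous_kernelSup (hK : IsConeKernel K) (φ : C(X, ℝ)) :
    Continuous fun A : JBar X => kernelSup K A φ := by
  simp only [kernelSup_eq_sSup hK]
  exact (continuous_sSup_image_nonemptyCompacts (continuous_kernelEval hK φ)).comp
    continuous_subtype_val

end Kernel

/-! ### Representing measures by subsets of the cone -/

section Representation

variable {X : Type*} [MetricSpace X] {μ : C(X, ℝ) → ℝ}

theorem monotone_of_map_sup (hsup : ∀ φ ψ, μ (φ ⊔ ψ) = max (μ φ) (μ ψ)) : Monotone μ := by
  intro φ ψ h
  rw [← sup_eq_right.2 h, hsup]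
  exact le_max_left _ _

variable [CompactSpace X]

/-- A functional preserving constants and maxima is at most `b` at `φ` as soon as, pointwise, `φ` can
be strictly exceeded by functions on which the functional is at most `b`. -/
theorem le_of_forall_exists_lt (hconst : ∀ c, μ (ContinuousMap.const X c) = c)
    (hsup : ∀ φ ψ, μ (φ ⊔ ψ) = max (μ φ) (μ ψ)) {φ : C(X, ℝ)} {b : ℝ}
    (h : ∀ x, ∃ θ : C(X, ℝ), φ x < θ x ∧ μ θ ≤ b) : μ φ ≤ b := by
  obtain ⟨θ, hθ, hb⟩ : ∃ θ : C(X, ℝ), (∀ x ∈ (univ : Set X), φ x < θ x) ∧ μ θ ≤ b := by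
    refine isCompact_univ.induction_on
      (p := fun S => ∃ θ : C(X, ℝ), (∀ x ∈ S, φ x < θ x) ∧ μ θ ≤ b) ?_ ?_ ?_ ?_
    · exact ⟨ContinuousMap.const X b, by simp, (hconst b).le⟩
    · rintro S T hST ⟨θ, hθ, hb⟩
      exact ⟨θ, fun x hx => hθ x (hST hx), hb⟩
    · rintro S T ⟨θ, hθ, hb⟩ ⟨θ', hθ', hb'⟩
      refine ⟨θ ⊔ θ', ?_, (hsup θ θ').trans_le (max_le hb hb')⟩
      rintro x (hx | hx)
      · exact (hθ x hx).trans_le le_sup_left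
      · exact (hθ' x hx).trans_le le_sup_right
    · intro x _
      obtain ⟨θ, hθ, hb⟩ := h x
      exact ⟨{y | φ y < θ y},
        mem_nhdsWithin_of_mem_nhds ((isOpen_lt φ.continuous θ.continuous).mem_nhds hθ),
        θ, fun _ hy => hy, hb⟩
  exact (monotone_of_map_sup hsup fun x => (hθ x (mem_univ x)).le).trans hb

variable [DiamLeOne X] {K : unitInterval → ℝ → EReal}

/-- A functional preserving constants and maxima is a supremum over a set in `JBar X`, provided that
for `b ≤ φ x` there is a level `t` with `b ≤ K t (φ x)` such that, if `(x, t)` is excluded from the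
representing set by some `ψ`, then some `θ` exceeds `φ` at `x` while `μ θ ≤ b`. -/
theorem exists_kernelSup_eq (hK : IsConeKernel K)
    (hconst : ∀ c, μ (ContinuousMap.const X c) = c)
    (hsup : ∀ φ ψ, μ (φ ⊔ ψ) = max (μ φ) (μ ψ))
    (hsep : ∀ (x : X) (φ : C(X, ℝ)) (b : ℝ), b ≤ φ x → ∃ t, (b : EReal) ≤ K t (φ x) ∧
      ∀ ψ : C(X, ℝ), (μ ψ : EReal) < K t (ψ x) → ∃ θ : C(X, ℝ), φ x < θ x ∧ μ θ ≤ b) :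
    ∃ A : JBar X, ∀ φ, kernelSup K A φ = μ φ := by
  -- Every representing set is contained in `S`, so `S` is the largest candidate.
  let S : Set (Cone X) := {p | ∀ φ : C(X, ℝ), kernelEval hK φ p ≤ μ φ}
  have hS : IsClosed S := by
    simp only [S, ofPred_forall]
    exact isClosed_iInter fun φ => isClosed_le (continuous_kernelEval hK φ) continuous_const
  have hle : ∀ (φ : C(X, ℝ)) (e : EReal),
      (∀ x t, Cone.mk x t ∈ S → K t (φ x) ≤ e) → (μ φ : EReal) ≤ e := by
    intro φ e he
    by_contra! hlt
    obtain ⟨b, heb, hbμ⟩ := EReal.lt_iff_exists_real_btwn.1 hlt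
    refine absurd (le_of_forall_exists_lt hconst hsup (φ := φ) (b := b) fun x => ?_)
      (not_le.2 (EReal.coe_lt_coe_iff.1 hbμ))
    rcases lt_or_ge (φ x) b with hx | hx
    · exact ⟨ContinuousMap.const X b, hx, (hconst b).le⟩
    · obtain ⟨t, hbt, ht⟩ := hsep x φ b hx
      by_contra hθ
      refine absurd (heb.trans_le (hbt.trans (he x t fun ψ => ?_))) (lt_irrefl e)
      by_contra! hψ
      exact hθ (ht ψ hψ)
  have hsat : IsSaturated S := fun x t hx t' ht' φ => (hK.mono ht' le_rfl).trans (hx φ)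
  have hne : Nonempty X := by
    -- On an empty space the constants `0` and `1` coincide.
    by_contra hX
    rw [not_nonempty_iff] at hX
    have h01 : ContinuousMap.const X (0 : ℝ) = ContinuousMap.const X 1 := by
      ext x
      exact hX.elim x
    have := (hconst 0).symm.trans ((congrArg μ h01).trans (hconst 1))
    exact zero_ne_one this
  have hzero : ∀ x, Cone.mk x 0 ∈ S := fun x φ => by
    rw [kernelEval_mk, hK.zero_left]
    exact bot_le
  have hcomp : IsCompact {t : unitInterval | ∃ x, Cone.mk x t ∈ S} := by
    have h := ((hS.preimage Cone.continuous_mk).isCompact).image continuous_snd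
    convert h using 1
    ext t
    constructor
    · rintro ⟨x, hx⟩
      exact ⟨(x, t), hx, rfl⟩
    · rintro ⟨⟨x, t'⟩, hx, rfl⟩
      exact ⟨x, hx⟩
  -- If the highest level `t` met by `S` were below `1`, then `hle` would fail for a constant.
  obtain ⟨t, ⟨x, hx⟩, ht⟩ := hcomp.exists_isGreatest ⟨0, hne.some, hzero _⟩
  have ht1 : t = 1 := by
    by_contra h1
    obtain ⟨r, hr⟩ := hK.exists_lt (lt_of_le_of_ne (unitInterval.le_one t) h1)
    rw [hK.one_left] at hr
    have h2 := hle (ContinuousMap.const X r) (K t r) fun y s hs => hK.mono (ht ⟨y, hs⟩) le_rfl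
    rw [hconst] at h2
    exact absurd hr (not_lt.2 h2)
  rw [ht1] at hx
  refine ⟨⟨⟨⟨S, hS.isCompact⟩, ⟨_, hx⟩⟩, hsat, x, hx⟩, fun φ => le_antisymm ?_ ?_⟩
  · exact kernelSup_le fun y s hs => hs φ
  · exact hle φ _ fun y s hs => le_kernelSup (K := K) φ hs

end Representation

/-! ### The max-min and max-plus kernels -/

theorem isConeKernel_min (ξ : unitInterval ≃o EReal) :
    IsConeKernel fun t r => min (ξ t) (r : EReal) where
  continuous := (ξ.continuous.comp continuous_fst).min
    (continuous_coe_real_ereal.comp continuous_snd)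
  mono hs hq := min_le_min (ξ.monotone hs) (EReal.coe_le_coe_iff.2 hq)
  zero_left r := by
    have h : ξ 0 = ⊥ := ξ.map_bot
    simp [h]
  one_left r := by
    have h : ξ 1 = ⊤ := ξ.map_top
    simp [h]
  exists_lt {s t} hst := by
    obtain ⟨r, h1, h2⟩ := EReal.lt_iff_exists_real_btwn.1 (ξ.strictMono hst)
    exact ⟨r, by rwa [min_eq_left h1.le, min_eq_right h2.le]⟩

theorem strictMono_lnI : StrictMono lnI := fun s _ h =>
  ENNReal.log_strictMono ((ENNReal.ofReal_lt_ofReal_iff_of_nonneg s.2.1).2 h)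

theorem continuous_lnI : Continuous lnI :=
  ENNReal.continuous_log.comp (ENNReal.continuous_ofReal.comp continuous_subtype_val)

theorem isConeKernel_add : IsConeKernel fun t r => (r : EReal) + lnI t where
  continuous := by
    refine continuous_iff_continuousAt.2 fun p => ?_
    exact ContinuousAt.comp
      (f := fun p : unitInterval × ℝ => ((p.2 : EReal), lnI p.1)) (g := fun q => q.1 + q.2)
      (EReal.continuousAt_add (.inl (EReal.coe_ne_top _)) (.inl (EReal.coe_ne_bot _)))
      ((continuous_coe_real_ereal.comp continuous_snd).prodMk
        (continuous_lnI.comp continuous_fst)).continuousAt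
  mono hs hq := add_le_add (EReal.coe_le_coe_iff.2 hq) (strictMono_lnI.monotone hs)
  zero_left r := by simp [lnI]
  one_left r := by simp [lnI_one]
  exists_lt {s t} hst := ⟨0, by simpa using strictMono_lnI hst⟩

section Separation

variable {X : Type*} [MetricSpace X] {μ : C(X, ℝ) → ℝ}

/-- If `μ ψ < ψ x`, then there are functions with arbitrarily large value at `x` whose measure barely
exceeds `μ ψ`: stretching `ψ` above a level `d > c > μ ψ` does not affect the truncation at `d`. -/
theorem IsMaxMinMeasure.exists_large (hμ : IsMaxMinMeasure X μ) {ψ : C(X, ℝ)} {x : X} {c : ℝ}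
    (hc : μ ψ < c) (hcx : c < ψ x) (M : ℝ) : ∃ θ : C(X, ℝ), M < θ x ∧ μ θ ≤ c := by
  obtain ⟨d, hcd, hdx⟩ := exists_between hcx
  -- The slope `k` makes `ψ x + k * (ψ x - d)` exceed `M`.
  let k : ℝ := (|M - ψ x| + 1) / (ψ x - d)
  let θ : C(X, ℝ) := ⟨fun y => max c (ψ y + k * max 0 (ψ y - d)), by fun_prop⟩
  have hθ : ∀ y, θ y = max c (ψ y + k * max 0 (ψ y - d)) := fun y => rfl
  refine ⟨θ, ?_, ?_⟩
  · rw [hθ, max_eq_right (sub_pos.2 hdx).le, div_mul_cancel₀ _ (sub_pos.2 hdx).ne']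
    apply lt_max_of_lt_right
    linarith [le_abs_self (M - ψ x)]
  · have h : ContinuousMap.const X d ⊓ θ ≤ ContinuousMap.const X c ⊔ ψ := by
      intro y
      change min d (max c (ψ y + k * max 0 (ψ y - d))) ≤ max c (ψ y)
      rcases le_total (ψ y) d with hy | hy
      · rw [max_eq_left (sub_nonpos.2 hy), mul_zero, add_zero]
        exact inf_le_right
      · exact inf_le_left.trans (hy.trans le_sup_right)
    have h1 := monotone_of_map_sup hμ.map_sup h
    rw [hμ.map_const_inf, hμ.map_sup, hμ.map_const, max_eq_left hc.le] at h1
    exact (min_le_iff.1 h1).resolve_left (not_le.2 hcd)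

theorem IsMaxMinMeasure.exists_separating (hμ : IsMaxMinMeasure X μ) (ξ : unitInterval ≃o EReal)
    (x : X) (φ : C(X, ℝ)) (b : ℝ) (hb : b ≤ φ x) :
    ∃ t, (b : EReal) ≤ min (ξ t) (φ x : EReal) ∧
      ∀ ψ : C(X, ℝ), (μ ψ : EReal) < min (ξ t) (ψ x : EReal) →
        ∃ θ : C(X, ℝ), φ x < θ x ∧ μ θ ≤ b := by
  refine ⟨ξ.symm b, ?_, fun ψ hψ => ?_⟩
  · rw [ξ.apply_symm_apply]
    exact le_min le_rfl (EReal.coe_le_coe_iff.2 hb)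
  · rw [ξ.apply_symm_apply, ← ereal_coe_min, EReal.coe_lt_coe_iff] at hψ
    obtain ⟨c, hc, hcb⟩ := exists_between hψ
    obtain ⟨θ, hθ, hθc⟩ := hμ.exists_large hc (hcb.trans_le (min_le_right _ _)) (φ x)
    exact ⟨θ, hθ, hθc.trans (hcb.le.trans (min_le_left _ _))⟩

theorem IsIdempotentMeasure.exists_separating (hμ : IsIdempotentMeasure X μ)
    (x : X) (φ : C(X, ℝ)) (b : ℝ) (hb : b ≤ φ x) :
    ∃ t, (b : EReal) ≤ (φ x : EReal) + lnI t ∧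
      ∀ ψ : C(X, ℝ), (μ ψ : EReal) < (ψ x : EReal) + lnI t →
        ∃ θ : C(X, ℝ), φ x < θ x ∧ μ θ ≤ b := by
  -- The level is chosen so that `φ x + ln t = b`.
  let t : unitInterval := ⟨Real.exp (b - φ x), (Real.exp_pos _).le,
    Real.exp_le_one_iff.2 (sub_nonpos.2 hb)⟩
  have ht : lnI t = ((b - φ x : ℝ) : EReal) := by
    change ENNReal.log (ENNReal.ofReal (Real.exp (b - φ x))) = _
    rw [ENNReal.log_ofReal_of_pos (Real.exp_pos _), Real.log_exp]
  refine ⟨t, ?_, fun ψ hψ => ⟨ContinuousMap.const X (b - μ ψ) + ψ, ?_, ?_⟩⟩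
  · rw [ht, ← EReal.coe_add, add_sub_cancel]
  · rw [ht, ← EReal.coe_add, EReal.coe_lt_coe_iff] at hψ
    rw [ContinuousMap.add_apply, ContinuousMap.const_apply]
    linarith
  · rw [hμ.map_const_add, sub_add_cancel]

end Separation

/-! ### The homeomorphisms -/

section Homeomorphisms

variable {X : Type*} [MetricSpace X] [DiamLeOne X] [CompactSpace X]

/-- A map from `JBar X` to a space of functionals that is given by suprema of a cone kernel and
satisfies the representation property is a homeomorphism. -/
theorem isHomeomorph_of_kernelSup {K : unitInterval → ℝ → EReal} (hK : IsConeKernel K)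
    {P : (C(X, ℝ) → ℝ) → Prop} (f : JBar X → {μ // P μ})
    (hf : ∀ A φ, (((f A).1 φ : ℝ) : EReal) = kernelSup K A φ)
    (hrep : ∀ μ, P μ → ∃ A : JBar X, ∀ φ, kernelSup K A φ = μ φ) : IsHomeomorph f := by
  refine isHomeomorph_iff_continuous_bijective.2 ⟨?_, fun A B h => ?_, fun μ => ?_⟩
  · refine continuous_induced_rng.2 (continuous_pi fun φ => ?_)
    refine EReal.isEmbedding_coe.continuous_iff.2 ?_
    exact (continuous_kernelSup hK φ).congr fun A => (hf A φ).symm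
  · refine kernelSup_injective hK (funext fun φ => ?_)
    rw [← hf, ← hf, h]
  · obtain ⟨A, hA⟩ := hrep μ.1 μ.2
    refine ⟨A, Subtype.ext (funext fun φ => ?_)⟩
    rw [← EReal.coe_eq_coe_iff, hf, hA]

theorem isHomeomorph_hMap (ξ : unitInterval ≃o EReal) :
    IsHomeomorph (hMap ξ : JBar X → J X) :=
  isHomeomorph_of_kernelSup (isConeKernel_min ξ) _ (coe_toReal_hSup ξ) fun _ hμ =>
    exists_kernelSup_eq (isConeKernel_min ξ) hμ.map_const hμ.map_sup (hμ.exists_separating ξ)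

theorem isHomeomorph_gMap : IsHomeomorph (gMap : JBar X → I X) :=
  isHomeomorph_of_kernelSup isConeKernel_add _ coe_toReal_gSup fun _ hμ =>
    exists_kernelSup_eq isConeKernel_add hμ.map_const hμ.map_sup hμ.exists_separating

end Homeomorphisms

end MaxMin

end

theorem mainTheorem2 {X : Type*} [MetricSpace X] [CompactSpace X] [MaxMin.DiamLeOne X] :
    (∀ ξ : unitInterval ≃o EReal,
      IsHomeomorph (MaxMin.hMap ξ : MaxMin.JBar X → MaxMin.J X)) ∧
    IsHomeomorph (MaxMin.gMap : MaxMin.JBar X → MaxMin.I X) ∧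
    Nonempty (MaxMin.J X ≃ₜ MaxMin.I X) := by
  -- An order isomorphism `[0,1] ≃o [-∞,∞]`, needed to compare the two spaces of measures.
  let ξ : unitInterval ≃o EReal :=
    ENNReal.orderIsoUnitIntervalBirational.symm.trans ENNReal.logOrderIso
  exact ⟨MaxMin.isHomeomorph_hMap, MaxMin.isHomeomorph_gMap,
    ⟨((MaxMin.isHomeomorph_hMap ξ).homeomorph _).symm.trans
      (MaxMin.isHomeomorph_gMap.homeomorph _)⟩⟩
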